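/- Let $N\in\mathbb N$ and $0<\lambda\le\Lambda$, and set $\tilde N_+=\frac{\lambda}{\Lambda}(N-1)+1$ and $\tilde N_-=\frac{\Lambda}{\lambda}(N-1)+1$; assume $\tilde N_\pm>2$. For a real symmetric $N\times N$ matrix $A$ with eigenvalues $\mu_1,\dots,\mu_N$ let $$\mathcal M^+(A)=\Lambda\sum_{\mu_i>0}\mu_i+\lambda\sum_{\mu_i<0}\mu_i,\qquad \mathcal M^-(A)=\lambda\sum_{\mu_i>0}\mu_i+\Lambda\sum_{\mu_i<0}\mu_i .$$ Let the sign $\pm$ be fixed, and let $p^\star_\pm>1$ be the critical exponent of $\mathcal M^\pm$, i.e. the exponent for which the problem $-\mathcal M^\pm(D^2u)=u^{p^\star_\pm}$, $u\ge 0$ in $\mathbb R^N$ has a fast decaying classical radial solution. Here a radial function $u(x)=U(|x|)$ is called fast decaying if, for some constant $c>0$, $$\lim_{r\to\infty} r^{\tilde N_\pm-2}U(r)=c,\qquad \lim_{r\to\infty} r^{\tilde N_\pm-1}U'(r)=-(\tilde N_\pm-2)\,c .$$ Let $U^\pm=U^\pm(|x|)$ be the fast decaying radial solution with $U^\pm(0)=1$,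 let $R_0^\pm>0$ be the unique radius such that $(U^\pm)''(R_0^\pm)=0$, and put $K_0^\pm=[U^\pm(R_0^\pm)]^{p^\star_\pm-1}(R_0^\pm)^2$. Then $r\mapsto r^{\tilde N_+-1}(U^+)^{p^\star_++1}$ is integrable on $(R_0^+,\infty)$ and $$\bigl(\tilde N_++2-p^\star_+(\tilde N_+-2)\bigr)\int_{R_0^+}^{\infty} r^{\tilde N_+-1}(U^+)^{p^\star_++1}\,dr=\frac{U^+(R_0^+)^{p^\star_++1}(R_0^+)^{\tilde N_+}}{\tilde N_+-1}\left[p^\star_+(\tilde N_+-2)-\tilde N_+-\frac{p^\star_++1}{\Lambda(\tilde N_+-1)}K_0^+\right].$$ Likewise $r\mapsto r^{\tilde N_--1}(U^-)^{p^\star_-+1}$ is integrable on $(R_0^-,\infty)$ and $$\bigl(\tilde N_-+2-p^\star_-(\tilde N_--2)\bigr)\int_{R_0^-}^{\infty} r^{\tilde N_--1}(U^-)^{p^\star_-+1}\,dr=\frac{U^-(R_0^-)^{p^\star_-+1}(R_0^-)^{\tilde N_-}}{\tilde N_--1}\left[p^\star_-(\tilde N_--2)-\tilde N_--\frac{p^\star_-+1}{\lambda(\tilde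 N_--1)}K_0^-\right].$$ -/

import Mathlib

open MeasureTheory Filter Topology Set

noncomputable section

namespace PucciCritical

/-- The maximal Pucci operator on (symmetric) matrices: `Λ` times the sum of the positive
eigenvalues plus `λ` times the sum of the negative ones. The eigenvalues are listed with
multiplicity, as the real roots of the characteristic polynomial. -/
def pucciSup (lam Lam : ℝ) {N : ℕ} (A : Matrix (Fin N) (Fin N) ℝ) : ℝ :=
  Lam * (A.charpoly.roots.filter (fun μ => 0 < μ)).sum
    + lam * (A.charpoly.roots.filter (fun μ => μ < 0)).sum

/-- The minimal Pucci operator on (symmetric) matrices. -/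
def pucciInf (lam Lam : ℝ) {N : ℕ} (A : Matrix (Fin N) (Fin N) ℝ) : ℝ :=
  lam * (A.charpoly.roots.filter (fun μ => 0 < μ)).sum
    + Lam * (A.charpoly.roots.filter (fun μ => μ < 0)).sum

/-- The Hessian matrix `D²u(x)` of a function on `ℝᴺ`. -/
def hessian {N : ℕ} (u : EuclideanSpace ℝ (Fin N) → ℝ) (x : EuclideanSpace ℝ (Fin N)) :
    Matrix (Fin N) (Fin N) ℝ :=
  Matrix.of fun i j =>
    fderiv ℝ (fderiv ℝ u) x (EuclideanSpace.single i 1) (EuclideanSpace.single j 1)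

/-- The dimension-like number of the maximal operator. -/
def dimSup (lam Lam : ℝ) (N : ℕ) : ℝ := lam / Lam * ((N : ℝ) - 1) + 1

/-- The dimension-like number of the minimal operator. -/
def dimInf (lam Lam : ℝ) (N : ℕ) : ℝ := Lam / lam * ((N : ℝ) - 1) + 1

/-- `x ↦ U(|x|)` is a classical (radial) solution of `-F(D²u) = u ^ p`, `u ≥ 0` in `ℝᴺ`.
Only the values of `U` on `[0, ∞)` matter. -/
structure IsRadialSolution {N : ℕ} (F : Matrix (Fin N) (Fin N) ℝ → ℝ) (p : ℝ) (U : ℝ → ℝ) :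
    Prop where
  contDiff : ContDiff ℝ 2 (fun x : EuclideanSpace ℝ (Fin N) => U ‖x‖)
  nonneg : ∀ x : EuclideanSpace ℝ (Fin N), 0 ≤ U ‖x‖
  equation : ∀ x : EuclideanSpace ℝ (Fin N),
    -F (hessian (fun y : EuclideanSpace ℝ (Fin N) => U ‖y‖) x) = U ‖x‖ ^ p

/-- Fast decay at infinity with respect to the dimension-like number `Nt`. -/
def IsFastDecaying (Nt : ℝ) (U : ℝ → ℝ) : Prop :=
  ∃ c : ℝ, 0 < c ∧
    Tendsto (fun r : ℝ => r ^ (Nt - 2) * U r) atTop (𝓝 c) ∧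
    Tendsto (fun r : ℝ => r ^ (Nt - 1) * deriv U r) atTop (𝓝 (-(Nt - 2) * c))

/-- `p > 1` is critical for `F` if the equation in `ℝᴺ` has a fast decaying radial solution. -/
def IsCriticalExponent {N : ℕ} (F : Matrix (Fin N) (Fin N) ℝ → ℝ) (Nt p : ℝ) : Prop :=
  1 < p ∧ ∃ U : ℝ → ℝ, IsRadialSolution F p U ∧ IsFastDecaying Nt U

/-- `U` is the radial profile of a fast decaying radial solution with value `1` at the origin. -/
structure IsNormalizedFastSolution {N : ℕ} (F : Matrix (Fin N) (Fin N) ℝ → ℝ) (Nt p : ℝ)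
    (U : ℝ → ℝ) : Prop where
  solution : IsRadialSolution F p U
  fast : IsFastDecaying Nt U
  at_zero : U 0 = 1

/-- `R` is the unique radius at which `U''` vanishes. -/
def IsInflectionRadius (U : ℝ → ℝ) (R : ℝ) : Prop :=
  0 < R ∧ deriv (deriv U) R = 0 ∧ ∀ r : ℝ, 0 < r → deriv (deriv U) r = 0 → r = R

/-- The number `K₀ = U(R₀) ^ (p - 1) R₀²`. -/
def K₀ (p : ℝ) (U : ℝ → ℝ) (R : ℝ) : ℝ := U R ^ (p - 1) * R ^ 2

end PucciCritical

end

namespace PucciCritical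

/-! Beyond its inflection radius `R` a fast decaying profile is convex and decreasing, so the
Hessian has one eigenvalue `U'' ≥ 0` and `N - 1` eigenvalues `U'/r < 0`. There the Pucci equation is
the Lane–Emden equation `U'' + (n - 1) U'/r = -U ^ p / l` in the fractional dimension `n`, with `l`
the ellipticity constant multiplying positive eigenvalues. Its Pohozaev energy has derivative a
constant times `r ^ (n - 1) * U ^ (p + 1)`. Integrating over `(R, ∞)` gives the identity: the energy
vanishes at infinity because `(n - 2) * p > n`, and at `R` the condition `U'' = 0` expresses `U'`
through `U`. The minimal operator is the maximal one with the two ellipticity constants exchanged,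
and the argument never compares them. -/

lemma roots_charpoly_diagonal {N : ℕ} (d : Fin N → ℝ) :
    (Matrix.diagonal d).charpoly.roots = Finset.univ.val.map d := by
  rw [Matrix.charpoly_diagonal, ← Polynomial.roots_multiset_prod_X_sub_C (Finset.univ.val.map d),
    Multiset.map_map]
  rfl

lemma sum_filter_map_univ {N : ℕ} (d : Fin N → ℝ) (P : ℝ → Prop) [DecidablePred P] :
    ((Finset.univ.val.map d).filter P).sum = ∑ i, if P (d i) then d i else 0 := by
  rw [Multiset.filter_map, ← Finset.sum_filter]
  rfl

/-- The Pucci operator on a diagonal matrix with one nonnegative entry and all others negative. -/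
lemma pucciSup_diagonal (lam Lam : ℝ) {N : ℕ} (i₀ : Fin N) {a b : ℝ} (ha : 0 ≤ a) (hb : b < 0) :
    pucciSup lam Lam (Matrix.diagonal fun i : Fin N => if i = i₀ then a else b)
      = Lam * a + lam * (((N : ℝ) - 1) * b) := by
  have h1 : ∀ i : Fin N, (if 0 < (if i = i₀ then a else b) then (if i = i₀ then a else b) else 0)
      = if i = i₀ then a else 0 := by
    intro i
    by_cases hi : i = i₀
    · simp only [hi, if_true]
      split_ifs with h
      · rfl
      · linarith
    · simp [hi, hb.le]
  have h2 : ∀ i : Fin N, (if (if i = i₀ then a else b) < 0 then (if i = i₀ then a else b) else 0)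
      = b - if i = i₀ then b else 0 := by
    intro i
    by_cases hi : i = i₀
    · simp [hi, ha]
    · simp [hi, hb]
  unfold pucciSup
  rw [roots_charpoly_diagonal, sum_filter_map_univ, sum_filter_map_univ]
  simp only [h1, h2, Finset.sum_sub_distrib, Finset.sum_ite_eq', Finset.mem_univ, if_true,
    Finset.sum_const, Finset.card_univ, Fintype.card_fin, nsmul_eq_mul]
  ring

/-! ### Regularity of the profile and the Hessian of a radial function. -/

variable {N : ℕ} {U : ℝ → ℝ}

lemma contDiffOn_profile (hN : 0 < N)
    (hu : ContDiff ℝ 2 (fun x : EuclideanSpace ℝ (Fin N) => U ‖x‖)) :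
    ContDiffOn ℝ 2 U (Ioi 0) := by
  have h : ContDiff ℝ 2 (fun r : ℝ => U ‖r • EuclideanSpace.single (⟨0, hN⟩ : Fin N) (1 : ℝ)‖) :=
    hu.comp (contDiff_id.smul contDiff_const)
  refine h.contDiffOn.congr fun r hr => ?_
  rw [norm_smul, PiLp.norm_single, norm_one, mul_one, Real.norm_of_nonneg (le_of_lt hr)]

lemma hasDerivAt_profile (hU : ContDiffOn ℝ 2 U (Ioi 0)) {r : ℝ} (hr : 0 < r) :
    HasDerivAt U (deriv U r) r :=
  ((hU.differentiableOn (by norm_num)).differentiableAt (Ioi_mem_nhds hr)).hasDerivAt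

lemma contDiffOn_deriv_profile (hU : ContDiffOn ℝ 2 U (Ioi 0)) :
    ContDiffOn ℝ 1 (deriv U) (Ioi 0) :=
  hU.deriv_of_isOpen isOpen_Ioi (by norm_num)

lemma hasDerivAt_deriv_profile (hU : ContDiffOn ℝ 2 U (Ioi 0)) {r : ℝ} (hr : 0 < r) :
    HasDerivAt (deriv U) (deriv (deriv U) r) r :=
  (((contDiffOn_deriv_profile hU).differentiableOn (by norm_num)).differentiableAt
    (Ioi_mem_nhds hr)).hasDerivAt

lemma continuousOn_deriv_deriv_profile (hU : ContDiffOn ℝ 2 U (Ioi 0)) :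
    ContinuousOn (deriv (deriv U)) (Ioi 0) :=
  (contDiffOn_deriv_profile hU).continuousOn_deriv_of_isOpen isOpen_Ioi (by norm_num)

lemma fderiv_radial (hU : ContDiffOn ℝ 2 U (Ioi 0)) {y : EuclideanSpace ℝ (Fin N)} (hy : y ≠ 0)
    (j : Fin N) :
    fderiv ℝ (fun x : EuclideanSpace ℝ (Fin N) => U ‖x‖) y (EuclideanSpace.single j 1)
      = deriv U ‖y‖ / ‖y‖ * y j := by
  have hy' : 0 < ‖y‖ := norm_pos_iff.2 hy
  -- Writing the norm as the root of its square yields an explicit derivative, `⟪y, ·⟫ / ‖y‖`.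
  have hn : HasFDerivAt (fun x : EuclideanSpace ℝ (Fin N) => Real.sqrt (‖x‖ ^ 2)) _ y :=
    (hasStrictFDerivAt_norm_sq y).hasFDerivAt.sqrt (by positivity)
  simp only [Real.sqrt_sq (norm_nonneg _)] at hn
  have h := (hasDerivAt_profile hU hy').comp_hasFDerivAt y hn
  have h' := h.fderiv
  simp only [Function.comp_def] at h'
  rw [h']
  simp [EuclideanSpace.inner_single_right]
  field_simp

/-- On a coordinate axis the radial and tangential directions are the basis vectors, so no
diagonalization is needed. The entries come from differentiating the gradient `U'(‖y‖) / ‖y‖ * y j`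
once more. -/
lemma hessian_radial (hu : ContDiff ℝ 2 (fun x : EuclideanSpace ℝ (Fin N) => U ‖x‖))
    (hU : ContDiffOn ℝ 2 U (Ioi 0)) (i₀ : Fin N) {r : ℝ} (hr : 0 < r) :
    hessian (fun x : EuclideanSpace ℝ (Fin N) => U ‖x‖) (EuclideanSpace.single i₀ r)
      = Matrix.diagonal fun i => if i = i₀ then deriv (deriv U) r else deriv U r / r := by
  set x : EuclideanSpace ℝ (Fin N) := EuclideanSpace.single i₀ r with hx
  have hxn : ‖x‖ = r := by
    rw [hx, PiLp.norm_single, Real.norm_of_nonneg hr.le]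
  have hx0 : x ≠ 0 := by rw [← norm_pos_iff, hxn]; exact hr
  ext i j
  have hd : DifferentiableAt ℝ
      (fderiv ℝ (fun x : EuclideanSpace ℝ (Fin N) => U ‖x‖)) x :=
    ((hu.fderiv_right (m := 1) (by norm_num)).differentiable (by norm_num)).differentiableAt
  have hc := (hd.hasFDerivAt.clm_apply
    (hasFDerivAt_const (EuclideanSpace.single j (1 : ℝ)) x))
  have hn : HasFDerivAt (fun x : EuclideanSpace ℝ (Fin N) => Real.sqrt (‖x‖ ^ 2)) _ x :=
    (hasStrictFDerivAt_norm_sq x).hasFDerivAt.sqrt (by rw [hxn]; positivity)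
  simp only [Real.sqrt_sq (norm_nonneg _)] at hn
  have hg : HasDerivAt (fun s => deriv U s / s)
      ((deriv (deriv U) r * r - deriv U r * 1) / r ^ 2) ‖x‖ := by
    rw [hxn]
    exact (hasDerivAt_deriv_profile hU hr).div (hasDerivAt_id r) hr.ne'
  have hp := (hg.comp_hasFDerivAt x hn).mul
    (EuclideanSpace.proj j : EuclideanSpace ℝ (Fin N) →L[ℝ] ℝ).hasFDerivAt
  have hev : (fun y : EuclideanSpace ℝ (Fin N) =>
      fderiv ℝ (fun x : EuclideanSpace ℝ (Fin N) => U ‖x‖) y (EuclideanSpace.single j 1))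
      =ᶠ[𝓝 x] fun y => deriv U ‖y‖ / ‖y‖ * y j := by
    filter_upwards [isOpen_ne.mem_nhds hx0] with y hy using fderiv_radial hU hy j
  have he := (hc.congr_of_eventuallyEq hev.symm).unique hp
  have he' := congrArg (fun L => L (EuclideanSpace.single i (1 : ℝ))) he
  simp [hxn, EuclideanSpace.inner_single_right] at he'
  simp only [hessian, Matrix.of_apply]
  rw [he']
  by_cases hij : i = j
  · subst hij
    by_cases hi : i = i₀
    · subst hi; simp [hx]; field_simp; ring
    · simp [hx, hi]
  · by_cases hi : i = i₀
    · subst hi; simp [hx, hij, Ne.symm hij]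
    · simp [hx, hij, hi, Ne.symm hij]

end PucciCritical

namespace PucciCritical

/-! ### Convexity beyond the inflection radius and the reduced radial equation. -/

variable {n p l R : ℝ} {U : ℝ → ℝ}

lemma tendsto_deriv_of_fast (hn : 2 < n) (hf : IsFastDecaying n U) :
    Tendsto (deriv U) atTop (𝓝 0) ∧ ∀ᶠ r in atTop, deriv U r < 0 := by
  obtain ⟨c, hc, -, h⟩ := hf
  constructor
  · have h1 := (tendsto_rpow_neg_atTop (y := n - 1) (by linarith)).mul h
    rw [zero_mul] at h1
    refine h1.congr' ?_
    filter_upwards [eventually_gt_atTop 0] with r hr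
    rw [← mul_assoc, ← Real.rpow_add hr]
    simp
  · have hneg : -(n - 2) * c < 0 := by nlinarith
    filter_upwards [h.eventually_lt_const hneg, eventually_gt_atTop 0] with r hr hr0
    have := Real.rpow_pos_of_pos hr0 (n - 1)
    by_contra hcon
    nlinarith [mul_nonneg this.le (not_lt.1 hcon)]

/-- A fast decaying profile is convex and strictly decreasing beyond its inflection radius. -/
lemma convex_decreasing_of_inflection (hU : ContDiffOn ℝ 2 U (Ioi 0)) (hn : 2 < n)
    (hf : IsFastDecaying n U) (hR : IsInflectionRadius U R) :
    ∀ r, R ≤ r → 0 ≤ deriv (deriv U) r ∧ deriv U r < 0 := by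
  obtain ⟨hR0, hRz, hRu⟩ := hR
  obtain ⟨hlim, hneg⟩ := tendsto_deriv_of_fast hn hf
  have hcont : ContinuousOn (deriv U) (Ici R) := fun r hr =>
    (hasDerivAt_deriv_profile hU (hR0.trans_le hr)).continuousAt.continuousWithinAt
  have hne : ∀ r ∈ Ioi R, deriv (deriv U) r ≠ 0 := fun r hr h0 =>
    (ne_of_gt hr) (hRu r (hR0.trans hr) h0)
  have hc2 : ContinuousOn (deriv (deriv U)) (Ioi R) :=
    (continuousOn_deriv_deriv_profile hU).mono (Ioi_subset_Ioi hR0.le)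
  have hpos : ∀ r ∈ Ioi R, 0 < deriv (deriv U) r := by
    by_contra! hcon
    obtain ⟨a, ha, ha0⟩ := hcon
    -- `U''` has no zero beyond `R`, hence constant sign. Were it negative, `U'` would decrease from
    -- a negative value and could not tend to `0`.
    have hall : ∀ r ∈ Ioi R, deriv (deriv U) r < 0 := by
      intro r hr
      by_contra! hr0
      obtain ⟨z, hz, hz0⟩ := isPreconnected_Ioi.intermediate_value ha hr hc2 ⟨ha0, hr0⟩
      exact hne z hz hz0
    have hanti : StrictAntiOn (deriv U) (Ici R) :=
      strictAntiOn_of_deriv_neg (convex_Ici R) hcont (by simpa using hall)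
    obtain ⟨b, hbneg, hbR⟩ := (hneg.and (eventually_ge_atTop R)).exists
    have : 0 ≤ deriv U b := le_of_tendsto hlim (by
      filter_upwards [eventually_ge_atTop b] with r hr
      exact hanti.antitoneOn hbR (hbR.trans hr) hr)
    linarith
  have hmono : StrictMonoOn (deriv U) (Ici R) :=
    strictMonoOn_of_deriv_pos (convex_Ici R) hcont (by simpa using hpos)
  intro r hr
  refine ⟨?_, ?_⟩
  · rcases hr.eq_or_lt with rfl | h
    · exact hRz.ge
    · exact (hpos r h).le
  -- The limit only gives `U' ≤ 0`; comparing with a later point makes it strict at `r`.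
  · have h1 : r + 1 ∈ Ici R := by simp only [mem_Ici]; linarith
    have h2 : deriv U (r + 1) ≤ 0 := ge_of_tendsto hlim (by
      filter_upwards [eventually_ge_atTop (r + 1)] with s hs
      exact hmono.monotoneOn h1 (le_trans (mem_Ici.1 h1) hs) hs)
    exact (hmono hr h1 (by linarith)).trans_le h2

/-- The radial form of the equation at a radius where the profile is convex and decreasing. -/
lemma radial_equation {N : ℕ} {lam Lam : ℝ} (hLam : 0 < Lam)
    (hN : 0 < N) (hs : IsRadialSolution (N := N) (pucciSup lam Lam) p U) {r : ℝ} (hr : 0 < r)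
    (h2 : 0 ≤ deriv (deriv U) r) (h1 : deriv U r < 0) :
    deriv (deriv U) r = -((dimSup lam Lam N - 1) * (deriv U r / r)) - U r ^ p / Lam := by
  have hU := contDiffOn_profile hN hs.contDiff
  have he := hs.equation (EuclideanSpace.single ⟨0, hN⟩ r)
  rw [hessian_radial hs.contDiff hU _ hr,
    pucciSup_diagonal lam Lam _ h2 (div_neg_of_neg_of_pos h1 hr), PiLp.norm_single,
    Real.norm_of_nonneg hr.le] at he
  rw [← he, dimSup]
  field_simp
  ring

lemma hasDerivAt_flux (hU : ContDiffOn ℝ 2 U (Ioi 0)) {r : ℝ} (hr : 0 < r)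
    (ho : deriv (deriv U) r = -((n - 1) * (deriv U r / r)) - U r ^ p / l) :
    HasDerivAt (fun s => s ^ (n - 1) * deriv U s) (-(r ^ (n - 1) * U r ^ p / l)) r := by
  have h := (Real.hasDerivAt_rpow_const (p := n - 1) (Or.inl hr.ne')).mul
    (hasDerivAt_deriv_profile hU hr)
  refine h.congr_deriv ?_
  rw [ho, Real.rpow_sub_one hr.ne' (n - 1)]
  ring

/-- Where the flux has a limit, `r ^ (n - 1) * U ^ p` is integrable. -/
lemma integrableOn_source (hl : 0 < l) (hR : 0 < R) (hU : ContDiffOn ℝ 2 U (Ioi 0))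
    (hf : IsFastDecaying n U) (h0 : ∀ r, R ≤ r → 0 ≤ U r)
    (ho : ∀ r, R ≤ r → deriv (deriv U) r = -((n - 1) * (deriv U r / r)) - U r ^ p / l) :
    IntegrableOn (fun r => r ^ (n - 1) * U r ^ p) (Ioi R) := by
  obtain ⟨c, hc, -, h⟩ := hf
  -- The flux `r ^ (n - 1) * U'` is monotone with a finite limit, so its derivative is integrable.
  have hi := integrableOn_Ioi_deriv_of_nonpos'
    (fun r hr => hasDerivAt_flux hU (hR.trans_le hr) (ho r hr))
    (fun r hr => by
      have := Real.rpow_nonneg (h0 r (le_of_lt hr)) p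
      have := Real.rpow_nonneg (hR.trans hr).le (n - 1)
      rw [neg_nonpos]; positivity) h
  refine IntegrableOn.congr_fun (hi.const_mul (-l)) (fun r _ => ?_) measurableSet_Ioi
  field_simp

/-- The exponent of a fast decaying solution lies above `n / (n - 2)`. -/
lemma lt_of_integrableOn_source (hp : 0 ≤ p) (hR : 0 < R) (hf : IsFastDecaying n U)
    (hi : IntegrableOn (fun r => r ^ (n - 1) * U r ^ p) (Ioi R)) :
    n < (n - 2) * p := by
  obtain ⟨c, hc, h, -⟩ := hf
  obtain ⟨T, hT⟩ := eventually_atTop.1 (h.eventually_const_lt (half_lt_self hc))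
  set S := max T R with hS
  have hS0 : 0 < S := hR.trans_le (le_max_right _ _)
  -- Eventually `r ^ (n - 2) * U > c / 2`, so the integrable source dominates a multiple of this
  -- power, whose exponent must then be below `-1`.
  have hd : IntegrableOn (fun r : ℝ => r ^ (n - 1 - (n - 2) * p)) (Ioi S) := by
    have hi' := (hi.mono_set (Ioi_subset_Ioi (le_max_right T R))).const_mul (((c / 2) ^ p)⁻¹)
    refine Integrable.mono' hi' ?_ ?_
    · exact (measurable_id.pow_const _).aestronglyMeasurable
    · refine (ae_restrict_mem measurableSet_Ioi).mono fun r hr => ?_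
      have hr0 : 0 < r := hS0.trans hr
      have h1 := hT r ((le_max_left T R).trans (le_of_lt hr))
      have hrp := Real.rpow_pos_of_pos hr0 (n - 2)
      have hUr : 0 < U r := by
        by_contra hcon
        nlinarith [mul_nonneg hrp.le (neg_nonneg.2 (not_lt.1 hcon))]
      have h2 : (c / 2) ^ p ≤ r ^ ((n - 2) * p) * U r ^ p := by
        rw [Real.rpow_mul hr0.le, ← Real.mul_rpow hrp.le hUr.le]
        exact Real.rpow_le_rpow (by positivity) h1.le hp
      have hcp := Real.rpow_pos_of_pos (half_pos hc) p
      have hq := Real.rpow_pos_of_pos hr0 (n - 1 - (n - 2) * p)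
      rw [Real.norm_of_nonneg hq.le, le_inv_mul_iff₀ hcp]
      have h3 : r ^ (n - 1) = r ^ (n - 1 - (n - 2) * p) * r ^ ((n - 2) * p) := by
        rw [← Real.rpow_add hr0]; congr 1; ring
      rw [h3]
      nlinarith [mul_le_mul_of_nonneg_left h2 hq.le]
  have := (integrableOn_Ioi_rpow_iff hS0).1 hd
  linarith

/-! ### The Pohozaev energy: derivative, limit and value at the inflection radius. -/

/-- The Pohozaev energy of a radial profile. -/
noncomputable def pohozaev (n p l : ℝ) (U : ℝ → ℝ) (r : ℝ) : ℝ :=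
  r ^ n * (deriv U r ^ 2 / 2 + U r ^ (p + 1) / (l * (p + 1)))
    + (n - 2) / 2 * (U r * (r ^ (n - 1) * deriv U r))

/-- After substituting the equation, the weight `(n - 2) / 2` cancels the `U' ^ 2` terms and the two
`U' * U ^ p` terms cancel each other. -/
lemma hasDerivAt_pohozaev (hp : 0 < p) (hl : 0 < l) (hU : ContDiffOn ℝ 2 U (Ioi 0)) {r : ℝ}
    (hr : 0 < r) (h0 : 0 ≤ U r)
    (ho : deriv (deriv U) r = -((n - 1) * (deriv U r / r)) - U r ^ p / l) :
    HasDerivAt (pohozaev n p l U)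
      ((n + 2 - p * (n - 2)) / (2 * (p + 1) * l) * (r ^ (n - 1) * U r ^ (p + 1))) r := by
  have hU1 := hasDerivAt_profile hU hr
  have h1 := (Real.hasDerivAt_rpow_const (p := n) (Or.inl hr.ne')).mul
    ((((hasDerivAt_deriv_profile hU hr).pow 2).div_const 2).add
      ((hU1.rpow_const (p := p + 1) (Or.inr (by linarith))).div_const (l * (p + 1))))
  have h2 := (hU1.mul (hasDerivAt_flux hU hr ho)).const_mul ((n - 2) / 2)
  refine (h1.add h2).congr_deriv ?_
  have e1 : r ^ n = r ^ (n - 1) * r := by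
    rw [← Real.rpow_add_one hr.ne']; congr 1; ring
  have e2 : U r ^ (p + 1) = U r ^ p * U r := Real.rpow_add_one' h0 (by linarith)
  simp only [Pi.add_apply, Pi.pow_apply, add_sub_cancel_right]
  rw [ho, e1, e2]
  field_simp
  ring

/-- Each of the three terms is a negative power of `r` times a convergent product of the rescaled
`U` and `U'`. -/
lemma tendsto_pohozaev (hn : 2 < n) (hp : 0 < p) (hnp : n < (n - 2) * p) (hf : IsFastDecaying n U)
    (h0 : ∀ᶠ r in atTop, 0 ≤ U r) :
    Tendsto (pohozaev n p l U) atTop (𝓝 0) := by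
  obtain ⟨c, hc, hA, hB⟩ := hf
  have t1 := ((tendsto_rpow_neg_atTop (y := n - 2) (by linarith)).mul (hB.pow 2)).div_const 2
  have t2 := ((tendsto_rpow_neg_atTop (y := (n - 2) * (p + 1) - n) (by nlinarith)).mul
    (hA.rpow_const (p := p + 1) (Or.inr (by linarith)))).div_const (l * (p + 1))
  have t3 := ((tendsto_rpow_neg_atTop (y := n - 2) (by linarith)).mul
    (hA.mul hB)).const_mul ((n - 2) / 2)
  have t := (t1.add t2).add t3
  simp only [zero_mul, zero_div, mul_zero, add_zero] at t
  refine t.congr' ?_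
  filter_upwards [h0, eventually_gt_atTop 0] with r hU hr
  have e0 : r ^ (-(n - 2)) * r ^ (n - 2) = 1 := by rw [← Real.rpow_add hr]; simp
  have e1 : r ^ n = r ^ (-(n - 2)) * (r ^ (n - 1)) ^ 2 := by
    rw [← Real.rpow_natCast, ← Real.rpow_mul hr.le, ← Real.rpow_add hr]
    congr 1; push_cast; ring
  have e2 : r ^ (-((n - 2) * (p + 1) - n)) * (r ^ (n - 2) * U r) ^ (p + 1)
      = r ^ n * U r ^ (p + 1) := by
    rw [Real.mul_rpow (Real.rpow_nonneg hr.le _) hU, ← Real.rpow_mul hr.le, ← mul_assoc,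
      ← Real.rpow_add hr]
    congr 2; ring
  rw [e2, pohozaev, mul_add, e1]
  linear_combination (n - 2) / 2 * (U r * (r ^ (n - 1) * deriv U r)) * e0

lemma pohozaev_at_inflection (hn : 2 < n) (hp : 1 < p) (hl : 0 < l) (hR : 0 < R) (h0 : 0 ≤ U R)
    (ho : deriv (deriv U) R = -((n - 1) * (deriv U R / R)) - U R ^ p / l)
    (hz : deriv (deriv U) R = 0) :
    -(2 * (p + 1) * l) * pohozaev n p l U R = U R ^ (p + 1) * R ^ n / (n - 1) *
      (p * (n - 2) - n - (p + 1) / (l * (n - 1)) * K₀ p U R) := by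
  have hn1 : 0 < n - 1 := by linarith
  -- With `U'' = 0` the equation becomes linear in `U'(R)`.
  have hd : deriv U R = -(R * U R ^ p / (l * (n - 1))) := by
    rw [hz] at ho
    field_simp at ho ⊢
    linarith
  have e1 : R ^ n = R ^ (n - 1) * R := by
    rw [← Real.rpow_add_one hR.ne']; congr 1; ring
  have e2 : U R ^ (p + 1) = U R ^ p * U R := Real.rpow_add_one' h0 (by linarith)
  have e3 : U R ^ p = U R ^ (p - 1) * U R := by
    rw [← Real.rpow_add_one' h0 (by linarith)]; congr 1; ring
  rw [pohozaev, K₀, hd, e1, e2, e3]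
  field_simp
  ring

theorem pohozaev_identity_sup {N : ℕ} {lam Lam : ℝ} (hLam : 0 < Lam)
    (hN : 0 < N) (hn : 2 < dimSup lam Lam N) (hp : 1 < p)
    (hU : IsNormalizedFastSolution (N := N) (pucciSup lam Lam) (dimSup lam Lam N) p U)
    (hR : IsInflectionRadius U R) :
    IntegrableOn (fun r : ℝ => r ^ (dimSup lam Lam N - 1) * U r ^ (p + 1)) (Ioi R) ∧
      (dimSup lam Lam N + 2 - p * (dimSup lam Lam N - 2)) *
          (∫ r in Ioi R, r ^ (dimSup lam Lam N - 1) * U r ^ (p + 1)) =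
        U R ^ (p + 1) * R ^ dimSup lam Lam N / (dimSup lam Lam N - 1) *
          (p * (dimSup lam Lam N - 2) - dimSup lam Lam N -
            (p + 1) / (Lam * (dimSup lam Lam N - 1)) * K₀ p U R) := by
  have hC := contDiffOn_profile hN hU.solution.contDiff
  have hR0 := hR.1
  have hcd := convex_decreasing_of_inflection hC hn hU.fast hR
  have h0 : ∀ r, R ≤ r → 0 ≤ U r := fun r hr => by
    have := hU.solution.nonneg (EuclideanSpace.single ⟨0, hN⟩ r)
    rwa [PiLp.norm_single, Real.norm_of_nonneg (hR0.le.trans hr)] at this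
  have ho := fun r (hr : R ≤ r) =>
    radial_equation hLam hN hU.solution (hR0.trans_le hr) (hcd r hr).1 (hcd r hr).2
  -- From here on only the radial equation in dimension `n` matters.
  generalize dimSup lam Lam N = n at *
  have hsrc := integrableOn_source hLam hR0 hC hU.fast h0 ho
  have hnp := lt_of_integrableOn_source (by linarith) hR0 hU.fast hsrc
  have hcU : ContinuousOn U (Ici R) := fun r hr =>
    (hasDerivAt_profile hC (hR0.trans_le hr)).continuousAt.continuousWithinAt
  have hanti : AntitoneOn U (Ici R) :=
    antitoneOn_of_deriv_nonpos (convex_Ici R) hcU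
      (fun r hr => (hasDerivAt_profile hC
        (hR0.trans_le (interior_subset hr))).differentiableAt.differentiableWithinAt)
      (fun r hr => (hcd r (interior_subset hr)).2.le)
  have hint : IntegrableOn (fun r : ℝ => r ^ (n - 1) * U r ^ (p + 1)) (Ioi R) := by
    -- The extra factor `U` is bounded by `U R`, as the profile decreases.
    have h1 : IntegrableOn (fun r : ℝ => U r * (r ^ (n - 1) * U r ^ p)) (Ioi R) := by
      refine hsrc.bdd_mul (c := U R)
        ((hcU.mono Ioi_subset_Ici_self).aestronglyMeasurable measurableSet_Ioi) ?_
      refine (ae_restrict_mem measurableSet_Ioi).mono fun r hr => ?_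
      rw [Real.norm_of_nonneg (h0 r (le_of_lt hr))]
      exact hanti self_mem_Ici (Ioi_subset_Ici_self hr) (le_of_lt hr)
    refine h1.congr_fun (fun r hr => ?_) measurableSet_Ioi
    simp only [Real.rpow_add_one' (h0 r (le_of_lt hr)) (by linarith : p + 1 ≠ 0)]
    ring
  refine ⟨hint, ?_⟩
  have hI := integral_Ioi_of_hasDerivAt_of_tendsto'
    (fun r hr => hasDerivAt_pohozaev (by linarith) hLam hC (hR0.trans_le hr) (h0 r hr) (ho r hr))
    (hint.const_mul _)
    (tendsto_pohozaev hn (by linarith) hnp hU.fast ((eventually_ge_atTop R).mono h0))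
  rw [integral_const_mul] at hI
  rw [← pohozaev_at_inflection hn hp hLam hR0 (h0 R le_rfl) (ho R le_rfl) hR.2.1]
  have hp1 : 0 < p + 1 := by linarith
  field_simp at hI
  linarith

lemma pos_of_two_lt_dimSup {N : ℕ} {lam Lam : ℝ} (hlam : 0 < lam) (hLam : 0 < Lam)
    (hn : 2 < dimSup lam Lam N) : 0 < N := by
  rcases Nat.eq_zero_or_pos N with rfl | h
  · have : 0 < lam / Lam := by positivity
    simp only [dimSup, Nat.cast_zero] at hn
    linarith
  · exact h

end PucciCritical

theorem mainTheorem4 (N : ℕ) (lam Lam : ℝ) (hlam : 0 < lam) (hLam : lam ≤ Lam)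
    (hNsup : 2 < PucciCritical.dimSup lam Lam N) (hNinf : 2 < PucciCritical.dimInf lam Lam N) :
    (∀ (p : ℝ) (U : ℝ → ℝ) (R₀ : ℝ),
      PucciCritical.IsCriticalExponent (N := N) (PucciCritical.pucciSup lam Lam)
        (PucciCritical.dimSup lam Lam N) p →
      PucciCritical.IsNormalizedFastSolution (N := N) (PucciCritical.pucciSup lam Lam)
        (PucciCritical.dimSup lam Lam N) p U →
      PucciCritical.IsInflectionRadius U R₀ →
      IntegrableOn (fun r : ℝ => r ^ (PucciCritical.dimSup lam Lam N - 1) * U r ^ (p + 1))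
        (Set.Ioi R₀) volume ∧
      (PucciCritical.dimSup lam Lam N + 2 - p * (PucciCritical.dimSup lam Lam N - 2)) *
          (∫ r in Set.Ioi R₀, r ^ (PucciCritical.dimSup lam Lam N - 1) * U r ^ (p + 1)) =
        U R₀ ^ (p + 1) * R₀ ^ PucciCritical.dimSup lam Lam N /
            (PucciCritical.dimSup lam Lam N - 1) *
          (p * (PucciCritical.dimSup lam Lam N - 2) - PucciCritical.dimSup lam Lam N -
            (p + 1) / (Lam * (PucciCritical.dimSup lam Lam N - 1)) *
              PucciCritical.K₀ p U R₀)) ∧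
    (∀ (p : ℝ) (U : ℝ → ℝ) (R₀ : ℝ),
      PucciCritical.IsCriticalExponent (N := N) (PucciCritical.pucciInf lam Lam)
        (PucciCritical.dimInf lam Lam N) p →
      PucciCritical.IsNormalizedFastSolution (N := N) (PucciCritical.pucciInf lam Lam)
        (PucciCritical.dimInf lam Lam N) p U →
      PucciCritical.IsInflectionRadius U R₀ →
      IntegrableOn (fun r : ℝ => r ^ (PucciCritical.dimInf lam Lam N - 1) * U r ^ (p + 1))
        (Set.Ioi R₀) volume ∧
      (PucciCritical.dimInf lam Lam N + 2 - p * (PucciCritical.dimInf lam Lam N - 2)) *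
          (∫ r in Set.Ioi R₀, r ^ (PucciCritical.dimInf lam Lam N - 1) * U r ^ (p + 1)) =
        U R₀ ^ (p + 1) * R₀ ^ PucciCritical.dimInf lam Lam N /
            (PucciCritical.dimInf lam Lam N - 1) *
          (p * (PucciCritical.dimInf lam Lam N - 2) - PucciCritical.dimInf lam Lam N -
            (p + 1) / (lam * (PucciCritical.dimInf lam Lam N - 1)) *
              PucciCritical.K₀ p U R₀)) := by
  have hLam0 : 0 < Lam := hlam.trans_le hLam
  refine ⟨fun p U R₀ hp hU hR => ?_, fun p U R₀ hp hU hR => ?_⟩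
  · exact PucciCritical.pohozaev_identity_sup hLam0
      (PucciCritical.pos_of_two_lt_dimSup hlam hLam0 hNsup) hNsup hp.1 hU hR
  -- `pucciInf lam Lam` and `dimInf lam Lam` unfold to `pucciSup Lam lam` and `dimSup Lam lam`.
  · exact PucciCritical.pohozaev_identity_sup (lam := Lam) (Lam := lam) hlam
      (PucciCritical.pos_of_two_lt_dimSup hLam0 hlam hNinf) hNinf hp.1 hU hR
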